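/- Theorem. A real Banach space $X$ has property $(*)$ if there is a constant $C_0$ such that for every Lipschitz function $f:X\to\mathbb R$ and every $\varepsilon>0$ there is a Lipschitz, $C^1$-smooth function $K:X\to\mathbb R$ with $|f(x)-K(x)|<\varepsilon$ for all $x\in X$ and $\operatorname{Lip}(K)\le C_0\operatorname{Lip}(f)$, where $\operatorname{Lip}$ denotes the best Lipschitz constant. Let $X$ be a real Banach space with property $(*)$, let $Y\subset X$ be a closed subset (not necessarily convex), let $Z:=\overline{\operatorname{span}}\{y-y' : y,y'\in Y\}$, and let $f:Y\to\mathbb R$ be a function. For a continuous map $D:Y\to Z^*$ we say that $f$ satisfies condition (E) for $D$ if for every $y\in Y$ and every $\varepsilon>0$ there is $r>0$ such that $$|f(z)-f(w)-D(y)(z-w)|\le \varepsilon\|z-w\|\qquad\text{for all } z,w\in Y\cap B(y,r),$$ where $B(y,r)$ is the open ball with centre $y$ and radius $r$. 1. $f$ satisfies condition (E) for some continuous $D:Y\to Z^*$ if and only if there is a $C^1$-smooth function $H:X\to\mathbb R$ with $H|_Y=f$. 2. Assume moreover that $f$ is Lipschitz on $Y$. Then $f$ satisfies condition (E) for some continuous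 $D:Y\to Z^*$ with $\sup\{\|D(y)\|_{Z^*}:y\in Y\}<\infty$ if and only if there is a $C^1$-smooth and Lipschitz function $H:X\to\mathbb R$ with $H|_Y=f$. Furthermore, if $C_0$ is any constant for which $X$ has property $(*)$, $C_1:=33\,C_0$, and $f$ satisfies condition (E) for a continuous $D:Y\to Z^*$ with $M:=\sup\{\|D(y)\|_{Z^*}:y\in Y\}<\infty$ (read as $0$ if $Y=\emptyset$), then $H$ can be chosen so that in addition $$\operatorname{Lip}(H)\le (1+C_1)\,(M+\operatorname{Lip}(f)).$$ -/

import Mathlib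

open scoped NNReal

/-- A real-valued function is Lipschitz if it admits some Lipschitz constant. -/
def IsLip {α : Type*} [PseudoMetricSpace α] (h : α → ℝ) : Prop :=
  ∃ K : ℝ≥0, LipschitzWith K h

/-- `Lip h`: the best Lipschitz constant of a Lipschitz function `h`. It is only used together
with `IsLip h`. -/
noncomputable def Lip {α : Type*} [PseudoMetricSpace α] (h : α → ℝ) : ℝ :=
  ((sInf {K : ℝ≥0 | LipschitzWith K h} : ℝ≥0) : ℝ)

/-- Property (*) holds for `X` with the constant `C₀`. -/
def PropertyStarWith (X : Type*) [NormedAddCommGroup X] [NormedSpace ℝ X] (C₀ : ℝ) : Prop :=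
  ∀ f : X → ℝ, IsLip f → ∀ ε : ℝ, 0 < ε →
    ∃ K : X → ℝ, IsLip K ∧ ContDiff ℝ 1 K ∧ (∀ x, |f x - K x| < ε) ∧ Lip K ≤ C₀ * Lip f

/-- Property (*). -/
def PropertyStar (X : Type*) [NormedAddCommGroup X] [NormedSpace ℝ X] : Prop :=
  ∃ C₀ : ℝ, PropertyStarWith X C₀

/-- The closed linear span `Z` of the differences of points of `Y`. -/
def diffSpan {X : Type*} [NormedAddCommGroup X] [NormedSpace ℝ X] (Y : Set X) :
    Submodule ℝ X :=
  (Submodule.span ℝ {v : X | ∃ y ∈ Y, ∃ y' ∈ Y, v = y - y'}).topologicalClosure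

theorem sub_mem_diffSpan {X : Type*} [NormedAddCommGroup X] [NormedSpace ℝ X] {Y : Set X}
    (z w : Y) : (z : X) - (w : X) ∈ diffSpan Y :=
  Submodule.le_topologicalClosure _
    (Submodule.subset_span ⟨(z : X), z.2, (w : X), w.2, rfl⟩)

/-- The mean-value condition (E) for `f : Y → ℝ` and `D : Y → Z*`
(the continuity of `D` is stated separately). -/
def ConditionE {X : Type*} [NormedAddCommGroup X] [NormedSpace ℝ X] {Y : Set X}
    (f : Y → ℝ) (D : Y → (diffSpan Y →L[ℝ] ℝ)) : Prop :=
  ∀ y : Y, ∀ ε : ℝ, 0 < ε → ∃ r : ℝ, 0 < r ∧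
    ∀ z w : Y, (z : X) ∈ Metric.ball (y : X) r → (w : X) ∈ Metric.ball (y : X) r →
      |f z - f w - D y ⟨(z : X) - (w : X), sub_mem_diffSpan z w⟩| ≤ ε * ‖(z : X) - (w : X)‖

/-!
The implications from a `C¹` extension `H` to condition (E) only use that a `C¹` function is
strictly differentiable, with `D` the restriction of `H'` to `diffSpan Y`. The substance is the
construction of extensions, first for Lipschitz `f` and bounded `D`.

*One step.* Near a point `y` of `Y`, condition (E) says that `f` differs from a Hahn–Banach
extension `T` of `D y` by a function with a tiny Lipschitz constant on `Y`. A McShane extension of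
`f`, minus `T`, is therefore Lipschitz on `X`, with a tiny Lipschitz constant on `Y` near `y`;
`SmoothApprox.exists_approx_of_lipOn` smooths it while keeping both features. The resulting `C¹`
functions `δ` are uniformly as close to `f` as desired, have derivatives close to `D` on `Y`, and
`f - δ` has a small Lipschitz constant on `Y` near `y`. They are glued by a partition of unity.

*Gluing.* The multiplication by partition functions costs their Lipschitz constants, so the
approximation of index `k` must be accurate relative to the Lipschitz constant of index `k`, with
errors that can be summed even though `X` need not be separable. This is achieved by a
partition indexed by `ℕ × ι`, built on a `σ`-discrete refinement of the cover: at every point at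
most one function is nonzero for each `n : ℕ`, so errors proportional to `2⁻ⁿ` are summable
(`LipPartition`). The Lipschitz estimate for the glued function (`LipPartition.lipOn_sub_glue`)
holds on sets that need not be convex.

*Iteration.* One step leaves a remainder whose Lipschitz constant and derivative bound are an
eighth of the original ones (`LipData.exists_approx`). Iterating and summing gives the extension,
and the constants add up to less than `33 C₀` (`LipData.exists_extension`).

*No Lipschitz assumption.* Condition (E) is local, so the gluing of local approximations, without
any control off `Y`, gives a `C¹` function `h` for which `f - h` is Lipschitz on `Y` and
`D - h'` bounded (`SmoothApprox.exists_sub_lip`); the Lipschitz case applies to `f - h`.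
-/

section

open Set Filter Topology

/-! ### Lipschitz estimates with real constants -/

/-- `LipOn A L f`: the function `f` is `L`-Lipschitz on the set `A`. The constant is a real number,
so that the estimates below need no coercions from `ℝ≥0`. -/
def LipOn {X : Type*} [NormedAddCommGroup X] (A : Set X) (L : ℝ) (f : X → ℝ) : Prop :=
  ∀ x ∈ A, ∀ y ∈ A, |f x - f y| ≤ L * ‖x - y‖

/-- Uniform approximation of Lipschitz functions by `C¹` functions, with a loss of a factor `C` in
the Lipschitz constant: property (*) phrased with arbitrary Lipschitz constants instead of the
best one. -/
def SmoothApprox (X : Type*) [NormedAddCommGroup X] [NormedSpace ℝ X] (C : ℝ) : Prop :=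
  ∀ (L : ℝ) (f : X → ℝ), 0 ≤ L → LipOn univ L f → ∀ ε : ℝ, 0 < ε →
    ∃ K : X → ℝ, ContDiff ℝ 1 K ∧ LipOn univ (C * L) K ∧ ∀ x, |f x - K x| ≤ ε

section Lip

variable {α : Type*} [PseudoMetricSpace α]

theorem Lip_nonneg (f : α → ℝ) : 0 ≤ Lip f := NNReal.coe_nonneg _

theorem IsLip.dist_le {f : α → ℝ} (hf : IsLip f) (x y : α) :
    |f x - f y| ≤ Lip f * dist x y := by
  obtain ⟨K, hK⟩ := hf
  rcases (dist_nonneg (x := x) (y := y)).eq_or_lt with h | h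
  · simpa [← h, Real.dist_eq] using hK.dist_le_mul x y
  · have key : Real.toNNReal (|f x - f y| / dist x y) ≤ sInf {K : ℝ≥0 | LipschitzWith K f} := by
      refine le_csInf ⟨K, hK⟩ fun K' hK' => ?_
      rw [Real.toNNReal_le_iff_le_coe, div_le_iff₀ h]
      exact hK'.dist_le_mul x y
    rw [← div_le_iff₀ h]
    exact Real.toNNReal_le_iff_le_coe.1 key

theorem isLip_and_Lip_le {f : α → ℝ} {L : ℝ} (hL : 0 ≤ L)
    (h : ∀ x y, |f x - f y| ≤ L * dist x y) : IsLip f ∧ Lip f ≤ L := by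
  have h' : LipschitzWith L.toNNReal f := LipschitzWith.of_dist_le_mul fun x y => by
    rw [Real.coe_toNNReal L hL]; exact h x y
  refine ⟨⟨_, h'⟩, ?_⟩
  rw [← Real.coe_toNNReal L hL]
  exact NNReal.coe_le_coe.2
    (csInf_le (OrderBot.bddBelow {K : ℝ≥0 | LipschitzWith K f}) h')

end Lip

section LipOn

variable {X : Type*} [NormedAddCommGroup X]

theorem LipOn.mono {A B : Set X} {L : ℝ} {f : X → ℝ} (h : LipOn B L f) (hAB : A ⊆ B) :
    LipOn A L f := fun x hx y hy => h x (hAB hx) y (hAB hy)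

theorem LipOn.weaken {A : Set X} {L L' : ℝ} {f : X → ℝ} (h : LipOn A L f) (hL : L ≤ L') :
    LipOn A L' f := fun x hx y hy =>
  (h x hx y hy).trans (mul_le_mul_of_nonneg_right hL (norm_nonneg _))

theorem LipOn.add {A : Set X} {L L' : ℝ} {f g : X → ℝ} (hf : LipOn A L f) (hg : LipOn A L' g) :
    LipOn A (L + L') (fun x => f x + g x) := fun x hx y hy => by
  calc |f x + g x - (f y + g y)| = |(f x - f y) + (g x - g y)| := by ring_nf
    _ ≤ |f x - f y| + |g x - g y| := abs_add_le _ _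
    _ ≤ _ := by rw [add_mul]; exact add_le_add (hf x hx y hy) (hg x hx y hy)

theorem LipOn.sub {A : Set X} {L L' : ℝ} {f g : X → ℝ} (hf : LipOn A L f) (hg : LipOn A L' g) :
    LipOn A (L + L') (fun x => f x - g x) := fun x hx y hy => by
  calc |f x - g x - (f y - g y)| = |(f x - f y) - (g x - g y)| := by ring_nf
    _ ≤ |f x - f y| + |g x - g y| := abs_sub _ _
    _ ≤ _ := by rw [add_mul]; exact add_le_add (hf x hx y hy) (hg x hx y hy)

theorem LipOn.lipschitzWith {L : ℝ} (hL : 0 ≤ L) {f : X → ℝ} (h : LipOn univ L f) :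
    LipschitzWith L.toNNReal f :=
  LipschitzWith.of_dist_le_mul fun x y => by
    rw [Real.coe_toNNReal L hL, dist_eq_norm x y]; exact h x (mem_univ _) y (mem_univ _)

theorem LipschitzWith.lipOn {K : ℝ≥0} {f : X → ℝ} (h : LipschitzWith K f) : LipOn univ K f :=
  fun x _ y _ => by
    have := h.dist_le_mul x y
    rwa [dist_eq_norm x y] at this

theorem LipOn.isLip {L : ℝ} (hL : 0 ≤ L) {f : X → ℝ} (h : LipOn univ L f) :
    IsLip f ∧ Lip f ≤ L :=
  isLip_and_Lip_le hL fun x y => by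
    rw [dist_eq_norm]; exact h x (mem_univ _) y (mem_univ _)

theorem LipOn.exists_extension {A : Set X} {L : ℝ} (hL : 0 ≤ L) {f : X → ℝ} (h : LipOn A L f) :
    ∃ g : X → ℝ, LipOn univ L g ∧ ∀ x ∈ A, g x = f x := by
  have : LipschitzOnWith L.toNNReal f A := LipschitzOnWith.of_dist_le_mul fun x hx y hy => by
    rw [Real.coe_toNNReal L hL, dist_eq_norm x y]; exact h x hx y hy
  obtain ⟨g, hg, hfg⟩ := this.extend_real
  have hg' := hg.lipOn
  rw [Real.coe_toNNReal L hL] at hg'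
  exact ⟨g, hg', fun x hx => (hfg hx).symm⟩

theorem LipOn.mul {A : Set X} {L L' : ℝ} (hL : 0 ≤ L) {f g : X → ℝ}
    (hf : LipOn A L f) (hg : LipOn A L' g)
    (hf1 : ∀ x, |f x| ≤ 1) (hg1 : ∀ x, |g x| ≤ 1) :
    LipOn A (L + L') (fun x => f x * g x) := fun x hx y hy => by
  calc |f x * g x - f y * g y| = |(f x - f y) * g x + f y * (g x - g y)| := by ring_nf
    _ ≤ |(f x - f y) * g x| + |f y * (g x - g y)| := abs_add_le _ _
    _ ≤ (L * ‖x - y‖) * 1 + 1 * (L' * ‖x - y‖) := by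
        rw [abs_mul, abs_mul]
        gcongr
        · exact hf x hx y hy
        · exact hg1 x
        · exact hf1 y
        · exact hg x hx y hy
    _ = _ := by ring

variable [NormedSpace ℝ X]

theorem LipOn.norm_fderiv_le {L : ℝ} (hL : 0 ≤ L) {f : X → ℝ} (h : LipOn univ L f) (x : X) :
    ‖fderiv ℝ f x‖ ≤ L :=
  (norm_fderiv_le_of_lipschitz ℝ (h.lipschitzWith hL)).trans_eq (Real.coe_toNNReal L hL)

theorem lipOn_univ_of_norm_fderiv_le {L : ℝ} (hL : 0 ≤ L) {f : X → ℝ} (hf : Differentiable ℝ f)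
    (h : ∀ x, ‖fderiv ℝ f x‖ ≤ L) : LipOn univ L f := by
  have := (lipschitzWith_of_nnnorm_fderiv_le (C := L.toNNReal) hf
    fun x => (Real.le_toNNReal_iff_coe_le hL).2 (h x)).lipOn
  rwa [Real.coe_toNNReal L hL] at this

theorem lipOn_clm (T : X →L[ℝ] ℝ) (A : Set X) : LipOn A ‖T‖ T := fun x _ y _ => by
  rw [← map_sub]; exact T.le_opNorm _

theorem PropertyStarWith.smoothApprox {C : ℝ} (hC : 0 ≤ C) (h : PropertyStarWith X C) :
    SmoothApprox X C := by
  intro L f hL hf ε hε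
  obtain ⟨hf1, hf2⟩ := hf.isLip hL
  obtain ⟨K, hK, hK1, hK2, hK3⟩ := h f hf1 ε hε
  refine ⟨K, hK1, fun x _ y _ => ?_, fun x => (hK2 x).le⟩
  have := hK.dist_le x y
  rw [dist_eq_norm] at this
  refine this.trans (mul_le_mul_of_nonneg_right (hK3.trans ?_) (norm_nonneg _))
  exact mul_le_mul_of_nonneg_left hf2 hC

theorem PropertyStarWith.mono {C C' : ℝ} (hCC : C ≤ C') (h : PropertyStarWith X C) :
    PropertyStarWith X C' := fun f hf ε hε => by
  obtain ⟨K, hK, hK1, hK2, hK3⟩ := h f hf ε hε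
  exact ⟨K, hK, hK1, hK2, hK3.trans (mul_le_mul_of_nonneg_right hCC (Lip_nonneg f))⟩

/-- A function within bounded distance of a norming functional grows at rate `1` along some ray,
so smooth approximation cannot decrease the best Lipschitz constant. -/
theorem PropertyStarWith.one_le [Nontrivial X] {C : ℝ} (h : PropertyStarWith X C) : 1 ≤ C := by
  obtain ⟨v, hv⟩ := exists_ne (0 : X)
  obtain ⟨φ, hφ, hφv⟩ := exists_dual_vector ℝ v (norm_ne_zero_iff.2 hv)
  have hv0 : 0 < ‖v‖ := norm_pos_iff.2 hv
  have hlip := (lipOn_clm φ univ).isLip (norm_nonneg _)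
  obtain ⟨K, hK, -, hK2, hK3⟩ := h φ hlip.1 1 one_pos
  have hc0 := Lip_nonneg φ
  rw [hφ] at hlip
  have hgrow : ∀ t : ℝ, 0 < t → t * ‖v‖ - 2 ≤ C * Lip φ * (t * ‖v‖) := fun t ht => by
    have h1 := hK.dist_le (t • v) 0
    rw [dist_zero_right, norm_smul, Real.norm_of_nonneg ht.le] at h1
    have h2 := hK2 (t • v)
    have h3 := hK2 0
    have h4 := mul_le_mul_of_nonneg_right hK3 (by positivity : 0 ≤ t * ‖v‖)
    have h5 : φ (t • v) = t * ‖v‖ := by simp [hφv]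
    rw [h5] at h2
    rw [map_zero] at h3
    rw [abs_lt] at h2 h3
    have h6 := le_abs_self (K (t • v) - K 0)
    linarith [h2.1, h2.2, h3.1, h3.2]
  have hC1 : 1 ≤ C * Lip φ := by
    by_contra! hlt
    have h1 : 0 < 1 - C * Lip φ := by linarith
    have h2 := hgrow (3 / ((1 - C * Lip φ) * ‖v‖)) (by positivity)
    have h3 : (1 - C * Lip φ) * (3 / ((1 - C * Lip φ) * ‖v‖) * ‖v‖) = 3 := by field_simp
    linarith
  by_contra! hlt
  rcases le_or_gt C 0 with h0 | h0
  · linarith [mul_nonpos_of_nonpos_of_nonneg h0 hc0]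
  · nlinarith [hlip.2]

end LipOn

/-! ### Smooth bump functions -/

theorem contDiff_max_zero_sq : ContDiff ℝ 1 (fun t : ℝ => max 0 t ^ 2) := by
  have hder : ∀ t : ℝ, HasDerivAt (fun t : ℝ => max 0 t ^ 2) (2 * max 0 t) t := by
    intro t
    rcases lt_trichotomy t 0 with ht | rfl | ht
    · rw [max_eq_left ht.le, mul_zero]
      refine (hasDerivAt_const t (0 : ℝ)).congr_of_eventuallyEq ?_
      filter_upwards [Iio_mem_nhds ht] with s hs
      rw [max_eq_left (le_of_lt hs)]; norm_num
    · rw [max_self, mul_zero, ← hasDerivWithinAt_univ, ← Iic_union_Ici (a := (0 : ℝ))]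
      refine HasDerivWithinAt.union ?_ ?_
      · refine (hasDerivWithinAt_const 0 (Iic (0 : ℝ)) (0 : ℝ)).congr (fun s hs => ?_) (by simp)
        rw [max_eq_left (mem_Iic.1 hs)]; norm_num
      · have : HasDerivWithinAt (fun t : ℝ => t ^ 2) 0 (Ici 0) 0 := by
          simpa using (hasDerivAt_pow 2 (0 : ℝ)).hasDerivWithinAt (s := Ici 0)
        exact this.congr (fun s hs => by rw [max_eq_right (mem_Ici.1 hs)]) (by simp)
    · rw [max_eq_right ht.le]
      have : HasDerivAt (fun t : ℝ => t ^ 2) (2 * t) t := by simpa using hasDerivAt_pow 2 t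
      refine this.congr_of_eventuallyEq ?_
      filter_upwards [Ioi_mem_nhds ht] with s hs
      rw [max_eq_right (le_of_lt hs)]
  rw [contDiff_one_iff_deriv]
  refine ⟨fun t => (hder t).differentiableAt, ?_⟩
  rw [funext fun t => (hder t).deriv]
  fun_prop

/-- A `C¹` step function, equal to `1` on `(-∞, 0]` and to `0` on `[1, ∞)`. -/
noncomputable def stepDown (t : ℝ) : ℝ := max 0 (1 - max 0 t ^ 2) ^ 2

theorem contDiff_stepDown : ContDiff ℝ 1 stepDown :=
  contDiff_max_zero_sq.comp (contDiff_const.sub contDiff_max_zero_sq)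

theorem stepDown_of_nonpos {t : ℝ} (ht : t ≤ 0) : stepDown t = 1 := by
  simp [stepDown, max_eq_left ht]

theorem stepDown_of_one_le {t : ℝ} (ht : 1 ≤ t) : stepDown t = 0 := by
  rw [stepDown, max_eq_right (by linarith : (0 : ℝ) ≤ t), max_eq_left (by nlinarith)]
  norm_num

theorem stepDown_nonneg (t : ℝ) : 0 ≤ stepDown t := sq_nonneg _

theorem stepDown_eq_clamp (t : ℝ) : stepDown t = (1 - min 1 (max 0 t) ^ 2) ^ 2 := by
  rcases le_total t 1 with h | h
  · have h1 : max 0 t ≤ 1 := max_le zero_le_one h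
    have h2 : 0 ≤ max 0 t := le_max_left _ _
    rw [stepDown, min_eq_right h1, max_eq_right (by nlinarith : (0 : ℝ) ≤ 1 - max 0 t ^ 2)]
  · rw [stepDown_of_one_le h, min_eq_left (h.trans (le_max_right _ _))]; norm_num

theorem stepDown_le_one (t : ℝ) : stepDown t ≤ 1 := by
  rw [stepDown_eq_clamp]
  have h1 : 0 ≤ min 1 (max 0 t) := le_min zero_le_one (le_max_left _ _)
  have h2 : min 1 (max 0 t) ≤ 1 := min_le_left _ _
  have h3 : min 1 (max 0 t) ^ 2 ≤ 1 := by nlinarith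
  nlinarith [sq_nonneg (min 1 (max 0 t))]

theorem abs_stepDown_sub_le (s t : ℝ) : |stepDown s - stepDown t| ≤ 4 * |s - t| := by
  rw [stepDown_eq_clamp, stepDown_eq_clamp]
  have hst : |min 1 (max 0 s) - min 1 (max 0 t)| ≤ |s - t| :=
    (abs_min_sub_min_le_max 1 _ 1 _).trans
      (max_le (by simp) ((abs_max_sub_max_le_max 0 s 0 t).trans (max_le (by simp) le_rfl)))
  have ha0 : 0 ≤ min 1 (max 0 s) := le_min zero_le_one (le_max_left _ _)
  have ha1 : min 1 (max 0 s) ≤ 1 := min_le_left _ _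
  have hb0 : 0 ≤ min 1 (max 0 t) := le_min zero_le_one (le_max_left _ _)
  have hb1 : min 1 (max 0 t) ≤ 1 := min_le_left _ _
  generalize min 1 (max 0 s) = a at *
  generalize min 1 (max 0 t) = b at *
  have e : (1 - a ^ 2) ^ 2 - (1 - b ^ 2) ^ 2 = (a - b) * ((a + b) * (a ^ 2 + b ^ 2 - 2)) := by ring
  have h4 : |(a + b) * (a ^ 2 + b ^ 2 - 2)| ≤ 4 := by
    rw [abs_mul]
    have h5 : |a + b| ≤ 2 := abs_le.2 ⟨by linarith, by linarith⟩
    have h6 : |a ^ 2 + b ^ 2 - 2| ≤ 2 := abs_le.2 ⟨by nlinarith, by nlinarith⟩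
    nlinarith [abs_nonneg (a + b), abs_nonneg (a ^ 2 + b ^ 2 - 2)]
  rw [e, abs_mul]
  calc |a - b| * _ ≤ |s - t| * 4 := by gcongr
    _ = _ := by ring

variable {X : Type*} [NormedAddCommGroup X] [NormedSpace ℝ X]

/-- Smooth Urysohn functions: a `C¹` function equal to `1` near `E` and to `0` away from the
`η`-neighbourhood of `E`, with Lipschitz constant of the order `1 / η`. -/
theorem SmoothApprox.exists_bump {C : ℝ} (hX : SmoothApprox X C)
    (E : Set X) {η : ℝ} (hη : 0 < η) :
    ∃ φ : X → ℝ, ContDiff ℝ 1 φ ∧ (∀ x, 0 ≤ φ x) ∧ (∀ x, φ x ≤ 1) ∧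
      LipOn univ (8 * C / η) φ ∧ (∀ x, Metric.infDist x E < η / 8 → φ x = 1) ∧
      ∀ x, 7 / 8 * η ≤ Metric.infDist x E → φ x = 0 := by
  have hd : LipOn univ 1 (fun x => Metric.infDist x E) := by
    simpa using (Metric.lipschitz_infDist_pt E).lipOn
  obtain ⟨K, hK1, hK2, hK3⟩ := hX 1 _ zero_le_one hd (η / 8) (by positivity)
  refine ⟨fun x => stepDown ((K x - η / 4) / (η / 2)),
    contDiff_stepDown.comp ((hK1.sub contDiff_const).div_const _),
    fun x => stepDown_nonneg _, fun x => stepDown_le_one _, fun x _ y _ => ?_, fun x hx => ?_,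
    fun x hx => ?_⟩
  · refine (abs_stepDown_sub_le _ _).trans ?_
    have h1 := hK2 x (mem_univ _) y (mem_univ _)
    rw [← sub_div, sub_sub_sub_cancel_right, abs_div, abs_of_pos (half_pos hη)]
    calc 4 * (|K x - K y| / (η / 2)) ≤ 4 * (C * 1 * ‖x - y‖ / (η / 2)) := by gcongr
      _ = 8 * C / η * ‖x - y‖ := by field_simp; ring
  · refine stepDown_of_nonpos (div_nonpos_of_nonpos_of_nonneg ?_ (by positivity))
    have := (abs_le.1 (hK3 x)).1
    linarith
  · refine stepDown_of_one_le ?_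
    rw [le_div_iff₀ (by positivity)]
    have := (abs_le.1 (hK3 x)).2
    linarith

/-- If an `L`-Lipschitz function on `X` happens to be `e`-Lipschitz on a subset `A`, it can be
approximated uniformly on `X` by a `C¹` function that keeps both constants up to a factor. Near
`A` one smooths an `e`-Lipschitz extension of `F|_A`, elsewhere `F` itself; on the thin transition
region the two differ by little compared with its width. -/
theorem SmoothApprox.exists_approx_of_lipOn {C : ℝ} (hX : SmoothApprox X C) (hC : 1 ≤ C)
    {A : Set X} {e L η : ℝ} (he : 0 ≤ e) (heL : e ≤ L) (hL : 0 < L) (hη : 0 < η)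
    {F : X → ℝ} (hF : LipOn univ L F) (hFA : LipOn A e F) :
    ∃ G : X → ℝ, ContDiff ℝ 1 G ∧ LipOn univ (18 * C * L) G ∧ (∀ x, |F x - G x| ≤ η) ∧
      LipOn A (C * e) G ∧ ∀ x ∈ A, ‖fderiv ℝ G x‖ ≤ C * e := by
  have hC0 : 0 < C := by linarith
  rcases A.eq_empty_or_nonempty with rfl | hne
  · obtain ⟨G, h1, h2, h3⟩ := hX L F hL.le hF η hη
    exact ⟨G, h1, h2.weaken (by nlinarith [mul_pos hC0 hL]), h3, by simp [LipOn], by simp⟩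
  obtain ⟨Fe, hFe, hFeA⟩ := hFA.exists_extension he
  have hdist : ∀ x, |F x - Fe x| ≤ 2 * L * Metric.infDist x A := by
    intro x
    have h2L : 0 < 2 * L := by positivity
    rw [← div_le_iff₀' h2L]
    refine (Metric.le_infDist hne).2 fun y hy => ?_
    rw [div_le_iff₀' h2L, dist_eq_norm]
    have h1 := (hF.sub (hFe.weaken heL)) x (mem_univ _) y (mem_univ _)
    simp only [hFeA y hy, sub_self, sub_zero] at h1
    linarith
  -- on the `μ`-neighbourhood of `A` the extension `Fe` is within `2 * L * μ = η / 2` of `F`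
  set μ : ℝ := η / (4 * L) with hμ
  have hμ0 : 0 < μ := by positivity
  have hLμ : L * μ = η / 4 := by rw [hμ]; field_simp
  set τ : ℝ := L * μ / 16 with hτ
  have hτ0 : 0 < τ := by positivity
  obtain ⟨φ, hφ1, hφ0, hφle, hφL, hφA, hφfar⟩ := hX.exists_bump A hμ0
  obtain ⟨G₀, hG₀, hG₀L, hG₀F⟩ := hX L F hL.le hF τ hτ0
  obtain ⟨G₁, hG₁, hG₁L, hG₁F⟩ := hX e Fe he hFe τ hτ0
  have hGdiff : ∀ x, Metric.infDist x A < 7 / 8 * μ → |G₁ x - G₀ x| ≤ 17 / 8 * L * μ := by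
    intro x hx
    have h1 := abs_le.1 (hG₀F x)
    have h2 := abs_le.1 (hG₁F x)
    have h3 := abs_le.1 ((hdist x).trans
      (mul_le_mul_of_nonneg_left hx.le (by positivity : 0 ≤ 2 * L)))
    have h4 : 0 < L * μ := by positivity
    rw [hτ] at h1 h2
    exact abs_le.2 ⟨by linarith [h1.1, h2.2, h3.2], by linarith [h1.2, h2.1, h3.1]⟩
  set G : X → ℝ := fun x => φ x * G₁ x + (1 - φ x) * G₀ x with hG
  have hGc : ContDiff ℝ 1 G := (hφ1.mul hG₁).add ((contDiff_const.sub hφ1).mul hG₀)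
  have hnear : ∀ x ∈ A, G =ᶠ[𝓝 x] G₁ := by
    intro x hx
    have : ∀ᶠ y in 𝓝 x, Metric.infDist y A < μ / 8 :=
      (Metric.continuous_infDist_pt A).continuousAt.eventually_lt continuousAt_const
        (by rw [Metric.infDist_zero_of_mem hx]; positivity)
    filter_upwards [this] with y hy
    simp [hG, hφA y hy]
  have hCe : 0 ≤ C * e := by positivity
  refine ⟨G, hGc, ?_, fun x => ?_, fun x hx y hy => ?_, fun x hx => ?_⟩
  · refine lipOn_univ_of_norm_fderiv_le (by positivity) (hGc.differentiable (by norm_num))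
      fun x => ?_
    have d0 := (hG₀.differentiable (by norm_num) x).hasFDerivAt
    have d1 := (hG₁.differentiable (by norm_num) x).hasFDerivAt
    have dφ := (hφ1.differentiable (by norm_num) x).hasFDerivAt
    have hd : fderiv ℝ G x = φ x • fderiv ℝ G₁ x + (1 - φ x) • fderiv ℝ G₀ x
        + (G₁ x - G₀ x) • fderiv ℝ φ x := by
      have : HasFDerivAt G _ x := (dφ.mul d1).add ((dφ.const_sub 1).mul d0)
      rw [this.fderiv]
      ext v
      simp
      ring
    have n0 : ‖fderiv ℝ G₀ x‖ ≤ C * L := hG₀L.norm_fderiv_le (by positivity) x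
    have n1 : ‖fderiv ℝ G₁ x‖ ≤ C * L :=
      (hG₁L.norm_fderiv_le hCe x).trans (by gcongr)
    have nφ : ‖(G₁ x - G₀ x) • fderiv ℝ φ x‖ ≤ 17 * C * L := by
      rcases lt_or_ge (Metric.infDist x A) (7 / 8 * μ) with h | h
      · rw [norm_smul, Real.norm_eq_abs]
        calc _ ≤ (17 / 8 * L * μ) * (8 * C / μ) :=
              mul_le_mul (hGdiff x h) (hφL.norm_fderiv_le (by positivity) x) (norm_nonneg _)
                (by positivity)
          _ = 17 * C * L := by field_simp
      · -- `φ` attains its minimum `0` here, so its derivative vanishes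
        have : fderiv ℝ φ x = 0 :=
          IsLocalMin.fderiv_eq_zero (Eventually.of_forall fun y => by
            simpa [hφfar x h] using hφ0 y)
        rw [this, smul_zero, norm_zero]
        positivity
    rw [hd]
    refine (norm_add₃_le).trans ?_
    rw [norm_smul, norm_smul, Real.norm_of_nonneg (hφ0 x),
      Real.norm_of_nonneg (sub_nonneg.2 (hφle x))]
    have := mul_le_mul_of_nonneg_left n1 (hφ0 x)
    have := mul_le_mul_of_nonneg_left n0 (sub_nonneg.2 (hφle x))
    linarith
  · have h1 := hG₀F x
    rcases lt_or_ge (Metric.infDist x A) (7 / 8 * μ) with h | h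
    · have e1 : F x - G x = (F x - G₀ x) - φ x * (G₁ x - G₀ x) := by simp only [hG]; ring
      rw [e1]
      refine (abs_sub _ _).trans ?_
      rw [abs_mul, abs_of_nonneg (hφ0 x)]
      have := mul_le_mul (hφle x) (hGdiff x h) (abs_nonneg _) zero_le_one
      rw [hτ] at h1
      linarith
    · simp only [hG, hφfar x h, zero_mul, zero_add, sub_zero, one_mul]
      rw [hτ] at h1
      linarith
  · rw [(hnear x hx).eq_of_nhds, (hnear y hy).eq_of_nhds]
    exact hG₁L x (mem_univ _) y (mem_univ _)
  · rw [(hnear x hx).fderiv_eq]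
    exact hG₁L.norm_fderiv_le hCe x

/-! ### Lipschitz partitions of unity -/

/-- A locally finite `C¹` partition of unity subordinate to `s`, made of Lipschitz functions and
indexed by `ℕ × ι`, the function with index `(n, i)` vanishing off `s i`. The point of the index
`n` is the field `sum_weight_le`: the weights `2⁻⁽ⁿ⁺¹⁾` of the functions that are nonzero at a
given point add up to at most `1`, although the index set may be uncountable. Errors can thus be
prescribed index by index, in terms of the Lipschitz constants `L`, and still be summed. -/
structure LipPartition {ι : Type*} (s : ι → Set X) where
  /-- The functions of the partition. -/
  ψ : ℕ × ι → X → ℝ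
  /-- Lipschitz constants of the functions of the partition. -/
  L : ℕ × ι → ℝ
  contDiff : ∀ k, ContDiff ℝ 1 (ψ k)
  nonneg : ∀ k x, 0 ≤ ψ k x
  L_nonneg : ∀ k, 0 ≤ L k
  lip : ∀ k, LipOn univ (L k) (ψ k)
  eq_zero : ∀ k x, x ∉ s k.2 → ψ k x = 0
  locallyFinite : ∀ x, ∃ S : Finset (ℕ × ι), ∀ᶠ y in 𝓝 x, ∀ k, k ∉ S → ψ k y = 0
  sum_eq_one : ∀ (x : X) (S : Finset (ℕ × ι)), (∀ k, k ∉ S → ψ k x = 0) → ∑ k ∈ S, ψ k x = 1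
  sum_weight_le : ∀ (x : X) (S : Finset (ℕ × ι)), (∀ k ∈ S, ψ k x ≠ 0) →
    ∑ k ∈ S, (1 / 2 : ℝ) ^ (k.1 + 1) ≤ 1

theorem sum_half_pow_succ_le (T : Finset ℕ) : ∑ n ∈ T, (1 / 2 : ℝ) ^ (n + 1) ≤ 1 := by
  obtain ⟨N, hN⟩ := T.exists_nat_subset_range
  calc ∑ n ∈ T, (1 / 2 : ℝ) ^ (n + 1) ≤ ∑ n ∈ Finset.range N, (1 / 2 : ℝ) ^ (n + 1) :=
        Finset.sum_le_sum_of_subset_of_nonneg hN fun _ _ _ => by positivity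
    _ = (∑ n ∈ Finset.range N, (1 / 2 : ℝ) ^ n) * (1 / 2) := by
        rw [Finset.sum_mul]; simp only [pow_succ]
    _ ≤ 1 := by linarith [sum_geometric_two_le N]

/-- Every open cover of a metric space has a `σ`-discrete family of sets `E n i` exhausting the
space, the sets with the same `n` being far apart compared with the room they have in `s i`: put
`x` into `E n i` if `i` is the first index with `x ∈ s i`, for some well-ordering of the indices,
and `s i` contains the ball of radius `3 * 2⁻ⁿ` around `x`. -/
theorem exists_sigmaDiscrete {ι α : Type*} [PseudoMetricSpace α] {s : ι → Set α}
    (hs : ∀ i, IsOpen (s i)) (hcov : ∀ x, ∃ i, x ∈ s i) :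
    ∃ E : ℕ → ι → Set α, (∀ x, ∃ n i, x ∈ E n i) ∧
      (∀ n i x, x ∈ E n i → Metric.ball x (3 * (1 / 2) ^ n) ⊆ s i) ∧
      ∀ n i j x y, x ∈ E n i → y ∈ E n j → i ≠ j → 3 * (1 / 2 : ℝ) ^ n ≤ dist x y := by
  have hwf : WellFounded (WellOrderingRel : ι → ι → Prop) := IsWellFounded.wf
  have hfirst : ∀ x, ∃ i, x ∈ s i ∧ ∀ j, x ∈ s j → ¬ WellOrderingRel j i := fun x =>
    ⟨hwf.min {i | x ∈ s i} (hcov x), hwf.min_mem {i | x ∈ s i} (hcov x),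
      fun j hj => hwf.not_lt_min {i | x ∈ s i} hj⟩
  choose ind hind hmin using hfirst
  refine ⟨fun n i => {x | ind x = i ∧ Metric.ball x (3 * (1 / 2) ^ n) ⊆ s i}, fun x => ?_,
    fun n i x hx => hx.2, ?_⟩
  · obtain ⟨δ, hδ, hball⟩ := Metric.isOpen_iff.1 (hs (ind x)) x (hind x)
    obtain ⟨n, hn⟩ := exists_pow_lt_of_lt_one (by positivity : 0 < δ / 3)
      (by norm_num : (1 / 2 : ℝ) < 1)
    exact ⟨n, ind x, rfl, (Metric.ball_subset_ball (by linarith)).trans hball⟩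
  · have key : ∀ n i j x y, ind x = i → Metric.ball x (3 * (1 / 2) ^ n) ⊆ s i → ind y = j →
        WellOrderingRel i j → 3 * (1 / 2 : ℝ) ^ n ≤ dist x y := by
      rintro n i j x y - hx rfl hij
      by_contra! hlt
      exact hmin y i (hx (by rwa [Metric.mem_ball, dist_comm])) hij
    rintro n i j x y ⟨hx, hx'⟩ ⟨hy, hy'⟩ hij
    rcases trichotomous_of WellOrderingRel i j with h | h | h
    · exact key n i j x y hx hx' hy h
    · exact absurd h hij
    · rw [dist_comm]; exact key n j i y x hy hy' hx h

/-- The bump functions around `E` in terms of points of `E`, so that the empty set, for which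
`Metric.infDist` is `0`, is covered as well (by the zero function). -/
theorem SmoothApprox.exists_bump' {C : ℝ} (hX : SmoothApprox X C) (hC : 0 ≤ C)
    (E : Set X) {η : ℝ} (hη : 0 < η) :
    ∃ φ : X → ℝ, ContDiff ℝ 1 φ ∧ (∀ x, 0 ≤ φ x) ∧ (∀ x, φ x ≤ 1) ∧
      LipOn univ (8 * C / η) φ ∧ (∀ x ∈ E, ∀ᶠ y in 𝓝 x, φ y = 1) ∧
      ∀ x, φ x ≠ 0 → ∃ a ∈ E, dist x a < η := by
  rcases E.eq_empty_or_nonempty with rfl | hne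
  · exact ⟨fun _ => 0, contDiff_const, by simp, by simp,
      fun x _ y _ => by simp only [sub_self, abs_zero]; positivity, by simp, by simp⟩
  obtain ⟨φ, h1, h2, h3, h4, h5, h6⟩ := hX.exists_bump E hη
  refine ⟨φ, h1, h2, h3, h4, fun x hx => ?_, fun x hx => ?_⟩
  · have : ∀ᶠ y in 𝓝 x, Metric.infDist y E < η / 8 :=
      (Metric.continuous_infDist_pt E).continuousAt.eventually_lt continuousAt_const
        (by rw [Metric.infDist_zero_of_mem hx]; positivity)
    filter_upwards [this] with y hy using h5 y hy
  · have : Metric.infDist x E < η := by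
      by_contra! hle
      exact hx (h6 x (by linarith))
    exact (Metric.infDist_lt_iff hne).1 this

theorem SmoothApprox.exists_lipPartition {C : ℝ} (hX : SmoothApprox X C) (hC : 0 ≤ C)
    {ι : Type*} {s : ι → Set X} (hs : ∀ i, IsOpen (s i)) (hcov : ∀ x, ∃ i, x ∈ s i) :
    Nonempty (LipPartition s) := by
  classical
  obtain ⟨E, hE, hEs, hEsep⟩ := exists_sigmaDiscrete hs hcov
  have hr : ∀ n : ℕ, (0 : ℝ) < (1 / 2) ^ n := fun n => by positivity
  choose φ hφ1 hφ0 hφle hφL hφE hφsupp using fun n i => hX.exists_bump' hC (E n i) (hr n)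
  have hone : ∀ (n : ℕ) (x : X), ∃ i₀, ∀ y ∈ Metric.ball x ((1 / 2) ^ n / 2),
      ∀ j, j ≠ i₀ → φ n j y = 0 := by
    intro n x
    by_cases h : ∃ i₀, ∃ z ∈ Metric.ball x ((1 / 2) ^ n / 2), φ n i₀ z ≠ 0
    · obtain ⟨i₀, z, hz, hφz⟩ := h
      refine ⟨i₀, fun y hy j hj => ?_⟩
      by_contra hne
      obtain ⟨a, ha, hya⟩ := hφsupp n j y hne
      obtain ⟨b, hb, hzb⟩ := hφsupp n i₀ z hφz
      have h1 := hEsep n j i₀ a b ha hb hj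
      have h2 := dist_triangle4 a y z b
      have h3 := dist_triangle_right y z x
      rw [dist_comm a y] at h2
      rw [Metric.mem_ball] at hy hz
      linarith
    · push Not at h
      exact ⟨(hcov x).choose, fun y hy j _ => h j y hy⟩
  choose i₀ hi₀ using hone
  have hself : ∀ (n : ℕ) (x : X), x ∈ Metric.ball x ((1 / 2 : ℝ) ^ n / 2) := fun n x =>
    Metric.mem_ball_self (half_pos (hr n))
  -- at each point at most one of the functions `φ n i`, for fixed `n`, is nonzero; `Φ n` is
  -- their sum
  set Φ : ℕ → X → ℝ := fun n x => φ n (i₀ n x) x with hΦ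
  have hΦloc : ∀ n x, Φ n =ᶠ[𝓝 x] φ n (i₀ n x) := by
    intro n x
    filter_upwards [Metric.ball_mem_nhds x (half_pos (hr n))] with y hy
    simp only [hΦ]
    by_cases h : i₀ n y = i₀ n x
    · rw [h]
    · rw [hi₀ n x y hy _ h, hi₀ n y y (hself n y) _ (Ne.symm h)]
  have hΦc : ∀ n, ContDiff ℝ 1 (Φ n) := fun n => contDiff_iff_contDiffAt.2 fun x =>
    (hφ1 n (i₀ n x)).contDiffAt.congr_of_eventuallyEq (hΦloc n x)
  have hΦ0 : ∀ n x, 0 ≤ Φ n x := fun n x => hφ0 _ _ _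
  have hΦle : ∀ n x, Φ n x ≤ 1 := fun n x => hφle _ _ _
  have hΦL : ∀ n, LipOn univ (8 * C / (1 / 2) ^ n) (Φ n) := fun n =>
    lipOn_univ_of_norm_fderiv_le (by positivity) ((hΦc n).differentiable (by norm_num)) fun x => by
      rw [(hΦloc n x).fderiv_eq]
      exact (hφL n _).norm_fderiv_le (by positivity) x
  have hΦE : ∀ n i x, x ∈ E n i → ∀ᶠ y in 𝓝 x, Φ n y = 1 := by
    intro n i x hx
    filter_upwards [hφE n i x hx] with y hy
    have : i = i₀ n y := by
      by_contra hne
      rw [hi₀ n y y (hself n y) i hne] at hy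
      exact zero_ne_one hy
    simp only [hΦ, ← this, hy]
  -- the functions `Φ n * P n` telescope to `1`, as `P n` vanishes as soon as `Φ m = 1`, `m < n`
  set P : ℕ → X → ℝ := fun n x => ∏ m ∈ Finset.range n, (1 - Φ m x) with hP
  have hPsucc : ∀ n, P (n + 1) = fun x => P n x * (1 - Φ n x) := fun n =>
    funext fun x => Finset.prod_range_succ _ _
  have hPc : ∀ n, ContDiff ℝ 1 (P n) := fun n =>
    contDiff_prod fun m _ => contDiff_const.sub (hΦc m)
  have hP0 : ∀ n x, 0 ≤ P n x := fun n x =>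
    Finset.prod_nonneg fun m _ => sub_nonneg.2 (hΦle m x)
  have hPle : ∀ n x, P n x ≤ 1 := fun n x =>
    Finset.prod_le_one (fun m _ => sub_nonneg.2 (hΦle m x)) fun m _ => by linarith [hΦ0 m x]
  have hPabs : ∀ n x, |P n x| ≤ 1 := fun n x => by
    rw [abs_of_nonneg (hP0 n x)]; exact hPle n x
  have hPL : ∀ n, ∃ L, 0 ≤ L ∧ LipOn univ L (P n) := by
    intro n
    induction n with
    | zero => exact ⟨0, le_rfl, fun x _ y _ => by simp [hP]⟩
    | succ n ih =>
      obtain ⟨L, hL, hPn⟩ := ih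
      refine ⟨L + 8 * C / (1 / 2) ^ n, by positivity, ?_⟩
      rw [hPsucc]
      refine hPn.mul hL (fun x hx y hy => ?_) (hPabs n)
        fun x => abs_le.2 ⟨by linarith [hΦle n x], by linarith [hΦ0 n x]⟩
      have := hΦL n x hx y hy
      rwa [abs_sub_comm, show Φ n y - Φ n x = 1 - Φ n x - (1 - Φ n y) by ring] at this
  have hPsum : ∀ N x, ∑ n ∈ Finset.range N, Φ n x * P n x = 1 - P N x := by
    intro N x
    induction N with
    | zero => simp [hP]
    | succ N ih => rw [Finset.sum_range_succ, ih, hPsucc]; ring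
  have hPzero : ∀ m y, Φ m y = 1 → ∀ n, m < n → P n y = 0 := fun m y hy n hmn =>
    Finset.prod_eq_zero (Finset.mem_range.2 hmn) (by rw [hy, sub_self])
  have hψL : ∀ k : ℕ × ι, ∃ L, 0 ≤ L ∧ LipOn univ L (fun x => φ k.1 k.2 x * P k.1 x) := by
    intro k
    obtain ⟨L, hL, hPn⟩ := hPL k.1
    exact ⟨_, by positivity, (hφL k.1 k.2).mul (by positivity) hPn
      (fun x => by rw [abs_of_nonneg (hφ0 _ _ _)]; exact hφle _ _ _) (hPabs _)⟩
  choose L hL hψ using hψL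
  have hfin : ∀ m x y, (∀ n ∈ Finset.range (m + 1), y ∈ Metric.ball x ((1 / 2) ^ n / 2)) →
      Φ m y = 1 → ∀ k : ℕ × ι, k ∉ (Finset.range (m + 1)).image (fun n => (n, i₀ n x)) →
      φ k.1 k.2 y * P k.1 y = 0 := by
    rintro m x y hy hm ⟨n, j⟩ hk
    rcases lt_or_ge m n with hmn | hmn
    · rw [hPzero m y hm n hmn, mul_zero]
    · have hn : n ∈ Finset.range (m + 1) := Finset.mem_range.2 (by omega)
      have hj : j ≠ i₀ n x := by
        rintro rfl
        exact hk (Finset.mem_image.2 ⟨n, hn, rfl⟩)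
      rw [show φ (n, j).1 (n, j).2 y = 0 from hi₀ n x y (hy n hn) j hj, zero_mul]
  refine ⟨⟨fun k x => φ k.1 k.2 x * P k.1 x, L, fun k => (hφ1 _ _).mul (hPc _),
    fun k x => mul_nonneg (hφ0 _ _ _) (hP0 _ _), hL, hψ, fun k x hx => ?_, fun x => ?_,
    fun x S hS => ?_, fun x S hS => ?_⟩⟩
  · have : φ k.1 k.2 x = 0 := by
      by_contra hne
      obtain ⟨a, ha, hxa⟩ := hφsupp _ _ _ hne
      exact hx (hEs _ _ a ha (Metric.mem_ball.2 (by linarith [hr k.1])))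
    rw [this, zero_mul]
  · obtain ⟨m, i, hxm⟩ := hE x
    refine ⟨(Finset.range (m + 1)).image (fun n => (n, i₀ n x)), ?_⟩
    have hballs : ∀ᶠ y in 𝓝 x, ∀ n ∈ Finset.range (m + 1), y ∈ Metric.ball x ((1 / 2) ^ n / 2) :=
      (Filter.eventually_all_finset _).2 fun n _ => Metric.ball_mem_nhds x (half_pos (hr n))
    filter_upwards [hballs, hΦE m i x hxm] with y hy1 hy2 using hfin m x y hy1 hy2
  · obtain ⟨m, i, hxm⟩ := hE x
    have hm : Φ m x = 1 := (hΦE m i x hxm).self_of_nhds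
    have h0 := hfin m x x (fun n _ => hself n x) hm
    set S' := (Finset.range (m + 1)).image (fun n => (n, i₀ n x)) with hS'
    have h1 : ∑ k ∈ S, φ k.1 k.2 x * P k.1 x = ∑ k ∈ S', φ k.1 k.2 x * P k.1 x := by
      rw [Finset.sum_subset (Finset.subset_union_left (s₂ := S')) fun k _ hk => hS k hk,
        Finset.sum_subset (Finset.subset_union_right (s₁ := S)) fun k _ hk => h0 k hk]
    rw [h1, hS', Finset.sum_image fun a _ b _ hab => congrArg Prod.fst hab]
    exact (hPsum (m + 1) x).trans (by rw [hPzero m x hm _ (Nat.lt_succ_self m), sub_zero])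
  · have hidx : ∀ k ∈ S, k.2 = i₀ k.1 x := fun k hk => by
      by_contra hne
      exact hS k hk (by simp only [hi₀ k.1 x x (hself _ _) _ hne, zero_mul])
    have hinj : Set.InjOn Prod.fst (S : Set (ℕ × ι)) := fun a ha b hb hab =>
      Prod.ext hab (by rw [hidx a ha, hidx b hb, hab])
    have := sum_half_pow_succ_le (S.image Prod.fst)
    rwa [Finset.sum_image hinj] at this

/-! ### Gluing local approximations -/

namespace LipPartition

variable {ι : Type*} {s : ι → Set X} (P : LipPartition s)

/-- The relative accuracy with which the local approximation of index `k` has to be chosen. -/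
noncomputable def tol (k : ℕ × ι) : ℝ := (1 / 2) ^ (k.1 + 1) / (1 + P.L k)

theorem tol_pos (k : ℕ × ι) : 0 < P.tol k :=
  div_pos (by positivity) (by linarith [P.L_nonneg k])

theorem tol_le (k : ℕ × ι) : P.tol k ≤ (1 / 2) ^ (k.1 + 1) :=
  div_le_self (by positivity) (by linarith [P.L_nonneg k])

theorem L_mul_tol_le (k : ℕ × ι) : P.L k * P.tol k ≤ (1 / 2) ^ (k.1 + 1) := by
  have := P.L_nonneg k
  rw [tol, mul_div_assoc', div_le_iff₀ (by linarith)]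
  nlinarith [pow_pos (by norm_num : (0 : ℝ) < 1 / 2) (k.1 + 1)]

theorem mem_of_ne_zero {k : ℕ × ι} {x : X} (h : P.ψ k x ≠ 0) : x ∈ s k.2 := by
  by_contra hx
  exact h (P.eq_zero k x hx)

theorem exists_support (x : X) : ∃ S : Finset (ℕ × ι), ∀ k, k ∈ S ↔ P.ψ k x ≠ 0 := by
  classical
  obtain ⟨S, hS⟩ := P.locallyFinite x
  refine ⟨S.filter fun k => P.ψ k x ≠ 0, fun k => ?_⟩
  rw [Finset.mem_filter, and_iff_right_iff_imp]
  intro hk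
  by_contra hkS
  exact hk (hS.self_of_nhds k hkS)

/-- The function glued from the functions `δ k` by means of the partition of unity. -/
noncomputable def glue (δ : ℕ × ι → X → ℝ) (x : X) : ℝ := ∑ᶠ k, P.ψ k x * δ k x

variable {δ : ℕ × ι → X → ℝ}

theorem glue_eq {x : X} {S : Finset (ℕ × ι)} (hS : ∀ k, k ∉ S → P.ψ k x = 0) :
    P.glue δ x = ∑ k ∈ S, P.ψ k x * δ k x :=
  finsum_eq_sum_of_support_subset _ fun k hk => by
    by_contra hkS
    exact hk (by simp only [hS k hkS, zero_mul])

theorem sub_glue_eq {x : X} {S : Finset (ℕ × ι)} (hS : ∀ k, k ∉ S → P.ψ k x = 0) (c : ℝ) :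
    c - P.glue δ x = ∑ k ∈ S, P.ψ k x * (c - δ k x) := by
  simp only [mul_sub, Finset.sum_sub_distrib, ← Finset.sum_mul]
  rw [P.sum_eq_one x S hS, one_mul, P.glue_eq hS]

theorem contDiff_glue (hδ : ∀ k, ContDiff ℝ 1 (δ k)) : ContDiff ℝ 1 (P.glue δ) := by
  refine contDiff_iff_contDiffAt.2 fun x => ?_
  obtain ⟨S, hS⟩ := P.locallyFinite x
  have : ContDiff ℝ 1 fun y => ∑ k ∈ S, P.ψ k y * δ k y :=
    ContDiff.sum fun k _ => (P.contDiff k).mul (hδ k)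
  refine this.contDiffAt.congr_of_eventuallyEq ?_
  filter_upwards [hS] with y hy using P.glue_eq hy

theorem psi_le_one (k : ℕ × ι) (x : X) : P.ψ k x ≤ 1 := by
  classical
  obtain ⟨S, hS⟩ := P.exists_support x
  by_cases hk : k ∈ S
  · rw [← P.sum_eq_one x S fun k hk => by simpa using mt (hS k).2 hk]
    exact Finset.single_le_sum (fun k _ => P.nonneg k x) hk
  · have : P.ψ k x = 0 := by simpa using mt (hS k).2 hk
    rw [this]; exact zero_le_one

theorem abs_sub_glue_le {ε : ℝ} (hε : 0 ≤ ε) {A : Set X} {F : X → ℝ}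
    (hF : ∀ k, ∀ x ∈ A ∩ s k.2, |F x - δ k x| ≤ ε * P.tol k) {x : X} (hx : x ∈ A) :
    |F x - P.glue δ x| ≤ ε := by
  obtain ⟨S, hS⟩ := P.exists_support x
  rw [P.sub_glue_eq (S := S) fun k hk => by simpa using mt (hS k).2 hk]
  calc |∑ k ∈ S, P.ψ k x * (F x - δ k x)| ≤ ∑ k ∈ S, |P.ψ k x * (F x - δ k x)| :=
        Finset.abs_sum_le_sum_abs _ _
    _ ≤ ∑ k ∈ S, ε * (1 / 2) ^ (k.1 + 1) := by
        refine Finset.sum_le_sum fun k hk => ?_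
        rw [abs_mul, abs_of_nonneg (P.nonneg k x)]
        have h1 := (hF k x ⟨hx, P.mem_of_ne_zero ((hS k).1 hk)⟩).trans
          (mul_le_mul_of_nonneg_left (P.tol_le k) hε)
        exact (mul_le_of_le_one_left (abs_nonneg _) (P.psi_le_one k x)).trans h1
    _ ≤ ε := by
        rw [← Finset.mul_sum]
        exact mul_le_of_le_one_right hε (P.sum_weight_le x S fun k hk => (hS k).1 hk)

/-- Gluing preserves Lipschitz approximation on an arbitrary set `A`, convex or not: `F - δ k` need
only be Lipschitz on the part of `A` inside `s k.2`, because `ψ k` bridges the gap between a point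
inside and a point outside of `s k.2`. -/
theorem lipOn_sub_glue {ε e : ℝ} (hε : 0 ≤ ε) (he : 0 ≤ e) {A : Set X} {F : X → ℝ}
    (hF : ∀ k, ∀ x ∈ A ∩ s k.2, |F x - δ k x| ≤ ε * P.tol k)
    (hFL : ∀ k, LipOn (A ∩ s k.2) e (fun x => F x - δ k x)) :
    LipOn A (e + 2 * ε) (fun x => F x - P.glue δ x) := by
  classical
  intro z hz w hw
  obtain ⟨S, hS⟩ := P.exists_support z
  obtain ⟨T, hT⟩ := P.exists_support w
  have hSz : ∀ k, k ∉ S → P.ψ k z = 0 := fun k hk => by simpa using mt (hS k).2 hk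
  have hTw : ∀ k, k ∉ T → P.ψ k w = 0 := fun k hk => by simpa using mt (hT k).2 hk
  -- `a` and `b` bound the contributions of the functions active at `z`, and of those active at `w`
  set a : ℕ × ι → ℝ := fun k => if k ∈ S then ε * (1 / 2) ^ (k.1 + 1) else 0 with ha
  set b : ℕ × ι → ℝ := fun k => if k ∈ T then ε * (1 / 2) ^ (k.1 + 1) else 0 with hb
  have ha0 : ∀ k, 0 ≤ a k := fun k => by simp only [ha]; split_ifs <;> positivity
  have hb0 : ∀ k, 0 ≤ b k := fun k => by simp only [hb]; split_ifs <;> positivity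
  have hψ : ∀ k (x : X), x ∈ A ∩ s k.2 →
      |P.ψ k z - P.ψ k w| * |F x - δ k x| ≤ ε * (1 / 2) ^ (k.1 + 1) * ‖z - w‖ := by
    intro k x hx
    calc _ ≤ (P.L k * ‖z - w‖) * (ε * P.tol k) :=
          mul_le_mul (P.lip k z (mem_univ _) w (mem_univ _)) (hF k x hx) (abs_nonneg _)
            (mul_nonneg (P.L_nonneg k) (norm_nonneg _))
      _ = ε * (P.L k * P.tol k) * ‖z - w‖ := by ring
      _ ≤ _ := by have := P.L_mul_tol_le k; gcongr
  have hterm : ∀ k, |P.ψ k z * (F z - δ k z) - P.ψ k w * (F w - δ k w)| ≤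
      (P.ψ k z * e + a k + b k) * ‖z - w‖ := by
    intro k
    have hn := norm_nonneg (z - w)
    have hp := mul_nonneg (mul_nonneg (P.nonneg k z) he) hn
    have h1 := mul_nonneg (ha0 k) hn
    have h2 := mul_nonneg (hb0 k) hn
    rw [add_mul, add_mul]
    by_cases hkS : k ∈ S
    · have hzs : z ∈ A ∩ s k.2 := ⟨hz, P.mem_of_ne_zero ((hS k).1 hkS)⟩
      have hak : a k = ε * (1 / 2) ^ (k.1 + 1) := if_pos hkS
      by_cases hws : w ∈ s k.2
      · have e1 : P.ψ k z * (F z - δ k z) - P.ψ k w * (F w - δ k w) =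
            P.ψ k z * ((F z - δ k z) - (F w - δ k w)) +
              (P.ψ k z - P.ψ k w) * (F w - δ k w) := by ring
        rw [e1]
        refine (abs_add_le _ _).trans ?_
        rw [abs_mul, abs_mul, abs_of_nonneg (P.nonneg k z)]
        have h3 := mul_le_mul_of_nonneg_left (hFL k z hzs w ⟨hw, hws⟩) (P.nonneg k z)
        have h4 := hψ k w ⟨hw, hws⟩
        rw [← hak] at h4
        linarith
      · have h3 := hψ k z hzs
        rw [P.eq_zero k w hws, sub_zero, ← hak, ← abs_mul] at h3
        rw [P.eq_zero k w hws, zero_mul, sub_zero]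
        linarith
    · rw [hSz k hkS, zero_mul, zero_sub, abs_neg]
      rw [hSz k hkS, zero_mul] at hp
      by_cases hkT : k ∈ T
      · have hbk : b k = ε * (1 / 2) ^ (k.1 + 1) := if_pos hkT
        have h3 := hψ k w ⟨hw, P.mem_of_ne_zero ((hT k).1 hkT)⟩
        rw [hSz k hkS, zero_sub, abs_neg, ← hbk, ← abs_mul] at h3
        linarith
      · rw [hTw k hkT, zero_mul, abs_zero]
        linarith
  have hSU : ∀ k, k ∉ S ∪ T → P.ψ k z = 0 := fun k hk =>
    hSz k fun h => hk (Finset.mem_union_left _ h)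
  have hTU : ∀ k, k ∉ S ∪ T → P.ψ k w = 0 := fun k hk =>
    hTw k fun h => hk (Finset.mem_union_right _ h)
  have hasum : ∑ k ∈ S ∪ T, a k ≤ ε := by
    simp only [ha]
    rw [Finset.sum_ite_mem, Finset.inter_eq_right.2 Finset.subset_union_left, ← Finset.mul_sum]
    exact mul_le_of_le_one_right hε (P.sum_weight_le z S fun k hk => (hS k).1 hk)
  have hbsum : ∑ k ∈ S ∪ T, b k ≤ ε := by
    simp only [hb]
    rw [Finset.sum_ite_mem, Finset.inter_eq_right.2 Finset.subset_union_right, ← Finset.mul_sum]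
    exact mul_le_of_le_one_right hε (P.sum_weight_le w T fun k hk => (hT k).1 hk)
  beta_reduce
  rw [P.sub_glue_eq hSU, P.sub_glue_eq hTU, ← Finset.sum_sub_distrib]
  refine (Finset.abs_sum_le_sum_abs _ _).trans ((Finset.sum_le_sum fun k _ => hterm k).trans ?_)
  rw [← Finset.sum_mul, Finset.sum_add_distrib, Finset.sum_add_distrib, ← Finset.sum_mul,
    P.sum_eq_one z _ hSU]
  refine mul_le_mul_of_nonneg_right ?_ (norm_nonneg _)
  linarith

/-- Gluing preserves approximation of derivatives. The derivatives of the functions of the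
partition add up to `0`, so they only multiply the differences `δ k x - c`. -/
theorem abs_fderiv_glue_sub_le {ε Λ c t : ℝ} (hε : 0 ≤ ε) {x v : X}
    (hδ : ∀ k, ContDiff ℝ 1 (δ k))
    (hc : ∀ k, x ∈ s k.2 → |c - δ k x| ≤ ε * P.tol k)
    (ht : ∀ k, x ∈ s k.2 → |fderiv ℝ (δ k) x v - t| ≤ Λ) :
    |fderiv ℝ (P.glue δ) x v - t| ≤ Λ + ε * ‖v‖ := by
  classical
  obtain ⟨S, hS⟩ := P.locallyFinite x
  have hSx := hS.self_of_nhds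
  have dψ : ∀ k, HasFDerivAt (P.ψ k) (fderiv ℝ (P.ψ k) x) x := fun k =>
    ((P.contDiff k).differentiable (by norm_num) x).hasFDerivAt
  have dδ : ∀ k, HasFDerivAt (δ k) (fderiv ℝ (δ k) x) x := fun k =>
    ((hδ k).differentiable (by norm_num) x).hasFDerivAt
  have hsum0 : ∑ k ∈ S, fderiv ℝ (P.ψ k) x = 0 := by
    have h1 : HasFDerivAt (fun y => ∑ k ∈ S, P.ψ k y) (∑ k ∈ S, fderiv ℝ (P.ψ k) x) x :=
      HasFDerivAt.fun_sum fun k _ => dψ k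
    have h2 : (fun y => ∑ k ∈ S, P.ψ k y) =ᶠ[𝓝 x] fun _ => (1 : ℝ) := by
      filter_upwards [hS] with y hy using P.sum_eq_one y S hy
    exact h1.unique ((hasFDerivAt_const (1 : ℝ) x).congr_of_eventuallyEq h2)
  have hglue : HasFDerivAt (P.glue δ)
      (∑ k ∈ S, (P.ψ k x • fderiv ℝ (δ k) x + δ k x • fderiv ℝ (P.ψ k) x)) x := by
    refine (HasFDerivAt.fun_sum fun k _ => (dψ k).mul (dδ k)).congr_of_eventuallyEq ?_
    filter_upwards [hS] with y hy
    exact P.glue_eq hy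
  have hzero : ∀ k, P.ψ k x = 0 → fderiv ℝ (P.ψ k) x = 0 := fun k hk =>
    IsLocalMin.fderiv_eq_zero (Eventually.of_forall fun y => by rw [hk]; exact P.nonneg k y)
  have hsum0v : ∑ k ∈ S, fderiv ℝ (P.ψ k) x v = 0 := by
    simpa using congrArg (fun T : X →L[ℝ] ℝ => T v) hsum0
  have heq : fderiv ℝ (P.glue δ) x v - t =
      ∑ k ∈ S, P.ψ k x * (fderiv ℝ (δ k) x v - t) -
        ∑ k ∈ S, (c - δ k x) * fderiv ℝ (P.ψ k) x v := by
    rw [hglue.fderiv]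
    simp only [mul_sub, sub_mul, Finset.sum_sub_distrib, ← Finset.sum_mul, ← Finset.mul_sum,
      P.sum_eq_one x S hSx, hsum0v, sum_apply, add_apply,
      smul_apply, smul_eq_mul, Finset.sum_add_distrib]
    ring
  have hfirst : |∑ k ∈ S, P.ψ k x * (fderiv ℝ (δ k) x v - t)| ≤ Λ := by
    calc _ ≤ ∑ k ∈ S, P.ψ k x * Λ := by
          refine (Finset.abs_sum_le_sum_abs _ _).trans (Finset.sum_le_sum fun k _ => ?_)
          rw [abs_mul, abs_of_nonneg (P.nonneg k x)]
          by_cases hk : P.ψ k x = 0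
          · simp [hk]
          · exact mul_le_mul_of_nonneg_left (ht k (P.mem_of_ne_zero hk)) (P.nonneg k x)
      _ = Λ := by rw [← Finset.sum_mul, P.sum_eq_one x S hSx, one_mul]
  have hsecond : |∑ k ∈ S, (c - δ k x) * fderiv ℝ (P.ψ k) x v| ≤ ε * ‖v‖ := by
    have hfilter : ∑ k ∈ S, (c - δ k x) * fderiv ℝ (P.ψ k) x v =
        ∑ k ∈ S with P.ψ k x ≠ 0, (c - δ k x) * fderiv ℝ (P.ψ k) x v := by
      refine (Finset.sum_filter_of_ne (p := fun k => P.ψ k x ≠ 0) fun k _ hne hk => hne ?_).symm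
      simp [hzero k hk]
    rw [hfilter]
    calc _ ≤ ∑ k ∈ S with P.ψ k x ≠ 0, (ε * ‖v‖) * (1 / 2) ^ (k.1 + 1) := by
          refine (Finset.abs_sum_le_sum_abs _ _).trans (Finset.sum_le_sum fun k hk => ?_)
          have hk' := (Finset.mem_filter.1 hk).2
          rw [abs_mul]
          have h1 : |fderiv ℝ (P.ψ k) x v| ≤ P.L k * ‖v‖ :=
            ((fderiv ℝ (P.ψ k) x).le_opNorm v).trans
              (mul_le_mul_of_nonneg_right ((P.lip k).norm_fderiv_le (P.L_nonneg k) x)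
                (norm_nonneg _))
          calc _ ≤ (ε * P.tol k) * (P.L k * ‖v‖) :=
                mul_le_mul (hc k (P.mem_of_ne_zero hk')) h1 (abs_nonneg _)
                  (mul_nonneg hε (P.tol_pos k).le)
            _ = (ε * ‖v‖) * (P.L k * P.tol k) := by ring
            _ ≤ _ := mul_le_mul_of_nonneg_left (P.L_mul_tol_le k) (by positivity)
      _ ≤ ε * ‖v‖ := by
          rw [← Finset.mul_sum]
          exact mul_le_of_le_one_right (by positivity)
            (P.sum_weight_le x _ fun k hk => (Finset.mem_filter.1 hk).2)
  rw [heq]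
  exact (abs_sub _ _).trans (add_le_add hfirst hsecond)

end LipPartition

/-! ### Condition (E) -/

/-- The derivative of `h` at the points of `Y`, restricted to `diffSpan Y`. -/
noncomputable def derivOn (Y : Set X) (h : X → ℝ) (y : Y) : diffSpan Y →L[ℝ] ℝ :=
  (fderiv ℝ h y).comp (diffSpan Y).subtypeL

theorem derivOn_apply {Y : Set X} (h : X → ℝ) (y : Y) (v : diffSpan Y) :
    derivOn Y h y v = fderiv ℝ h y v := rfl

theorem continuous_derivOn {Y : Set X} {h : X → ℝ} (hh : ContDiff ℝ 1 h) :
    Continuous (derivOn Y h) :=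
  ((hh.continuous_fderiv (by norm_num)).comp continuous_subtype_val).clm_comp continuous_const

theorem norm_derivOn_le (Y : Set X) {h : X → ℝ} {L : ℝ} (hL : 0 ≤ L) (hh : LipOn univ L h)
    (y : Y) : ‖derivOn Y h y‖ ≤ L :=
  ContinuousLinearMap.opNorm_le_bound _ hL fun v =>
    (fderiv ℝ h y).le_of_opNorm_le (hh.norm_fderiv_le hL y) v

/-- A `C¹` function is strictly differentiable, which is condition (E). -/
theorem conditionE_of_contDiff {Y : Set X} {h : X → ℝ} (hh : ContDiff ℝ 1 h) :
    ConditionE (fun y : Y => h y) (derivOn Y h) := by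
  intro y ε hε
  have hs := (hh.contDiffAt (x := (y : X))).hasStrictFDerivAt (by norm_num)
  obtain ⟨r, hr, hball⟩ := Metric.eventually_nhds_iff_ball.1 (hs.isLittleO.def hε)
  refine ⟨r, hr, fun z w hz hw => ?_⟩
  have := hball ((z : X), (w : X)) (by
    rw [← ball_prod_same]; exact ⟨hz, hw⟩)
  exact this

theorem ConditionE.sub {Y : Set X} {f g : Y → ℝ} {D D' : Y → (diffSpan Y →L[ℝ] ℝ)}
    (hf : ConditionE f D) (hg : ConditionE g D') :
    ConditionE (fun y => f y - g y) (fun y => D y - D' y) := by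
  intro y ε hε
  obtain ⟨r, hr, h1⟩ := hf y (ε / 2) (half_pos hε)
  obtain ⟨r', hr', h2⟩ := hg y (ε / 2) (half_pos hε)
  refine ⟨min r r', lt_min hr hr', fun z w hz hw => ?_⟩
  have h3 := h1 z w (Metric.ball_subset_ball (min_le_left _ _) hz)
    (Metric.ball_subset_ball (min_le_left _ _) hw)
  have h4 := h2 z w (Metric.ball_subset_ball (min_le_right _ _) hz)
    (Metric.ball_subset_ball (min_le_right _ _) hw)
  rw [sub_apply]
  generalize D y _ = a at *
  generalize D' y _ = b at *
  calc |f z - g z - (f w - g w) - (a - b)| = |(f z - f w - a) - (g z - g w - b)| := by ring_nf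
    _ ≤ |f z - f w - a| + |g z - g w - b| := abs_sub _ _
    _ ≤ _ := by linarith

/-- Near each point `y` of `Y`, a function satisfying condition (E) differs on `Y` from a
Hahn–Banach extension of `D y` by a function with a small Lipschitz constant. -/
theorem ConditionE.exists_local {Y : Set X} {F : X → ℝ} {D : Y → (diffSpan Y →L[ℝ] ℝ)}
    (hD : Continuous D) (hE : ConditionE (fun y : Y => F y) D) {e : ℝ} (he : 0 < e) (y : Y) :
    ∃ (T : X →L[ℝ] ℝ) (U : Set X), IsOpen U ∧ (y : X) ∈ U ∧ ‖T‖ = ‖D y‖ ∧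
      LipOn (Y ∩ U) e (fun x => F x - T x) ∧
      ∀ z : Y, (z : X) ∈ U → ∀ v : diffSpan Y, |T v - D z v| ≤ e * ‖v‖ := by
  obtain ⟨T, hT, hTn⟩ := exists_extension_norm_eq (diffSpan Y) (D y)
  obtain ⟨r, hr, h1⟩ := hE y e he
  have hcont : ∀ᶠ z in 𝓝 y, ‖D y - D z‖ < e :=
    have h0 : Continuous fun z => ‖D y - D z‖ :=
      continuous_norm (E := diffSpan Y →L[ℝ] ℝ).comp (continuous_const.sub hD)
    h0.continuousAt.eventually_lt continuousAt_const (by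
      rw [sub_self, ContinuousLinearMap.opNorm_zero]; exact he)
  obtain ⟨r', hr', h2⟩ := Metric.eventually_nhds_iff_ball.1 hcont
  refine ⟨T, Metric.ball y (min r r'), Metric.isOpen_ball,
    Metric.mem_ball_self (lt_min hr hr'), hTn, ?_, fun z hz v => ?_⟩
  · rintro z ⟨hz, hzU⟩ w ⟨hw, hwU⟩
    have h3 := h1 ⟨z, hz⟩ ⟨w, hw⟩ (Metric.ball_subset_ball (min_le_left _ _) hzU)
      (Metric.ball_subset_ball (min_le_left _ _) hwU)
    rw [← hT] at h3
    simp only [map_sub] at h3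
    rwa [show F z - T z - (F w - T w) = F z - F w - (T z - T w) by ring]
  · have h3 := h2 z (Metric.ball_subset_ball (min_le_right _ _) hz)
    rw [hT, ← sub_apply]
    exact (D y - D z).le_of_opNorm_le h3.le v

/-! ### One approximation step -/

/-- Gluing approximations that are available near each point of `Y`, and arbitrary functions off
`Y`. The set `Q` is where the values and Lipschitz constants of all approximations are controlled:
the whole space for Lipschitz data, the empty set otherwise. -/
theorem SmoothApprox.exists_glued {C : ℝ} (hX : SmoothApprox X C) (hC : 0 ≤ C)
    {Y : Set X} (hY : IsClosed Y) {F : X → ℝ} {D : Y → (diffSpan Y →L[ℝ] ℝ)}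
    {e ε Λ : ℝ} (he : 0 ≤ e) (hε : 0 < ε) (hΛ : 0 ≤ Λ) {Q : Set X}
    (hloc : ∀ y : Y, ∃ U : Set X, IsOpen U ∧ (y : X) ∈ U ∧ ∀ η : ℝ, 0 < η →
      ∃ δ : X → ℝ, ContDiff ℝ 1 δ ∧ (∀ x ∈ Y ∩ U, |F x - δ x| ≤ η) ∧
        LipOn (Y ∩ U) e (fun x => F x - δ x) ∧
        (∀ z : Y, (z : X) ∈ U → ∀ v : diffSpan Y, |fderiv ℝ δ z v - D z v| ≤ e * ‖v‖) ∧
        (∀ x ∈ Q, |F x - δ x| ≤ η) ∧ LipOn Q Λ (fun x => F x - δ x))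
    (hoff : ∀ η : ℝ, 0 < η → ∃ δ : X → ℝ, ContDiff ℝ 1 δ ∧
      (∀ x ∈ Q, |F x - δ x| ≤ η) ∧ LipOn Q Λ (fun x => F x - δ x)) :
    ∃ h : X → ℝ, ContDiff ℝ 1 h ∧ (∀ x ∈ Y, |F x - h x| ≤ ε) ∧
      LipOn Y (e + 2 * ε) (fun x => F x - h x) ∧
      (∀ y : Y, ‖D y - derivOn Y h y‖ ≤ e + ε) ∧
      LipOn Q (Λ + 2 * ε) (fun x => F x - h x) := by
  choose U hUo hUy hU using hloc
  set s : Option Y → Set X := fun o => o.elim Yᶜ U with hs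
  have hso : ∀ o, IsOpen (s o) := by
    rintro (_ | y)
    · exact hY.isOpen_compl
    · exact hUo y
  have hcov : ∀ x, ∃ o, x ∈ s o := fun x => by
    by_cases hx : x ∈ Y
    · exact ⟨some ⟨x, hx⟩, hUy ⟨x, hx⟩⟩
    · exact ⟨none, hx⟩
  obtain ⟨P⟩ := hX.exists_lipPartition hC hso hcov
  have hδ : ∀ k : ℕ × Option Y, ∃ δ : X → ℝ, ContDiff ℝ 1 δ ∧
      (∀ x ∈ Y ∩ s k.2, |F x - δ x| ≤ ε * P.tol k) ∧
      LipOn (Y ∩ s k.2) e (fun x => F x - δ x) ∧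
      (∀ z : Y, (z : X) ∈ s k.2 → ∀ v : diffSpan Y, |fderiv ℝ δ z v - D z v| ≤ e * ‖v‖) ∧
      (∀ x ∈ Q, |F x - δ x| ≤ ε * P.tol k) ∧ LipOn Q Λ (fun x => F x - δ x) := by
    intro k
    have hη : 0 < ε * P.tol k := mul_pos hε (P.tol_pos k)
    rcases k with ⟨n, _ | y⟩
    · obtain ⟨δ, h1, h2, h3⟩ := hoff _ hη
      exact ⟨δ, h1, fun x hx => absurd hx.1 hx.2, fun x hx => absurd hx.1 hx.2,
        fun z hz => absurd z.2 hz, h2, h3⟩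
    · exact hU y _ hη
  choose δ h1 h2 h3 h4 h5 h6 using hδ
  refine ⟨P.glue δ, P.contDiff_glue h1, fun x hx => P.abs_sub_glue_le hε.le h2 hx,
    P.lipOn_sub_glue hε.le he h2 h3, fun y => ?_, P.lipOn_sub_glue hε.le hΛ
      (fun k x hx => h5 k x hx.1) fun k => (h6 k).mono inter_subset_left⟩
  refine ContinuousLinearMap.opNorm_le_bound _ (by linarith) fun v => ?_
  rw [sub_apply, derivOn_apply, Real.norm_eq_abs, abs_sub_comm]
  have := P.abs_fderiv_glue_sub_le (c := F y) (t := D y v) (Λ := e * ‖v‖) (x := y) (v := v) hε.le h1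
    (fun k hk => h2 k y ⟨y.2, hk⟩) fun k hk => h4 k y hk v
  rw [add_mul]
  exact this

/-- Subtracting a suitable `C¹` function makes data satisfying condition (E) Lipschitz, with
bounded derivatives. -/
theorem SmoothApprox.exists_sub_lip {C : ℝ} (hX : SmoothApprox X C) (hC : 0 ≤ C)
    {Y : Set X} (hY : IsClosed Y) {F : X → ℝ} {D : Y → (diffSpan Y →L[ℝ] ℝ)}
    (hD : Continuous D) (hE : ConditionE (fun y : Y => F y) D) :
    ∃ h : X → ℝ, ContDiff ℝ 1 h ∧ LipOn Y (C + 3) (fun x => F x - h x) ∧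
      ∀ y : Y, ‖D y - derivOn Y h y‖ ≤ C + 3 := by
  have hglued := hX.exists_glued hC hY (F := F) (D := D) (e := 1 + C) (ε := 1)
    (Λ := 0) (Q := ∅) (by positivity) one_pos le_rfl
  obtain ⟨h, h1, -, h2, h3, -⟩ := hglued (fun y => by
    obtain ⟨T, U, hUo, hyU, -, hTL, hTD⟩ := hE.exists_local hD one_pos y
    obtain ⟨g, hg, hgF⟩ := hTL.exists_extension zero_le_one
    refine ⟨U, hUo, hyU, fun η hη => ?_⟩
    obtain ⟨G, hG, hGL, hGg⟩ := hX 1 g zero_le_one hg η hη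
    have hGL' := hGL
    rw [mul_one] at hGL'
    refine ⟨fun x => T x + G x, T.contDiff.add hG, fun x hx => ?_, ?_, fun z hz v => ?_, by simp,
      by simp [LipOn]⟩
    · have := hGg x
      rwa [hgF x hx, sub_sub] at this
    · have := hTL.sub (hGL'.mono (subset_univ (Y ∩ U)))
      simpa only [sub_sub] using this
    · have hd : HasFDerivAt (fun x => T x + G x) (T + fderiv ℝ G z) z :=
        T.hasFDerivAt.add (hG.differentiable (by norm_num) z).hasFDerivAt
      rw [hd.fderiv, add_apply, add_sub_right_comm, add_mul]
      refine (abs_add_le _ _).trans (add_le_add (hTD z hz v) ?_)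
      exact (fderiv ℝ G z).le_of_opNorm_le (hGL'.norm_fderiv_le hC z) (v : X))
    fun η _ => ⟨fun _ => 0, contDiff_const, by simp, by simp [LipOn]⟩
  exact ⟨h, h1, h2.weaken (by linarith), fun y => (h3 y).trans (by linarith)⟩

/-- Data `(F, D)` on `Y` satisfying condition (E), with `D` continuous, whose Lipschitz constant
and bound on `D` add up to at most `L`. -/
structure LipData (Y : Set X) (L : ℝ) (F : X → ℝ) (D : Y → (diffSpan Y →L[ℝ] ℝ)) : Prop where
  continuous : Continuous D
  conditionE : ConditionE (fun y : Y => F y) D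
  exists_bounds : ∃ l M : ℝ, 0 ≤ l ∧ 0 ≤ M ∧ LipOn Y l F ∧ (∀ y, ‖D y‖ ≤ M) ∧ l + M ≤ L

/-- The approximation step for Lipschitz data: a `C¹` function with a Lipschitz constant of order
`L` absorbs all but an eighth of the data. -/
theorem LipData.exists_approx {C : ℝ} (hX : SmoothApprox X C) (hC : 1 ≤ C)
    {Y : Set X} (hY : IsClosed Y) {L : ℝ} (hL : 0 < L) {F : X → ℝ}
    {D : Y → (diffSpan Y →L[ℝ] ℝ)} (hF : LipData Y L F D) :
    ∃ h : X → ℝ, ContDiff ℝ 1 h ∧ LipOn univ (22 * C * L) h ∧ (∀ x ∈ Y, |F x - h x| ≤ L) ∧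
      LipData Y (L / 8) (fun x => F x - h x) (fun y => D y - derivOn Y h y) := by
  obtain ⟨hD, hE, l, M, hl, hM, hFl, hDM, hlM⟩ := hF
  have hC0 : 0 ≤ C := by linarith
  have hCL : L ≤ C * L := by nlinarith
  obtain ⟨F', hF', hFF'⟩ := hFl.exists_extension hl
  have hE' : ConditionE (fun y : Y => F' y) D := by
    have : (fun y : Y => F' y) = fun y : Y => F y := funext fun y => hFF' y y.2
    rwa [this]
  -- the remaining Lipschitz constant is `(3 + C) * ε`
  set ε : ℝ := L / (16 * (3 + C)) with hε
  have hε0 : 0 < ε := by positivity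
  have hεL : (3 + C) * ε = L / 16 := by rw [hε]; field_simp
  have hCε : 0 ≤ C * ε := by positivity
  have hglued := hX.exists_glued hC0 hY (F := F') (D := D) (e := ε + C * ε)
    (ε := ε) (Λ := L + 18 * C * L) (Q := univ) (by positivity) hε0 (by positivity)
  obtain ⟨h, h1, h2, h3, h4, h5⟩ := hglued (fun y => by
    obtain ⟨T, U, hUo, hyU, hTn, hTL, hTD⟩ := hE'.exists_local hD hε0 y
    have hFT : LipOn univ L (fun x => F' x - T x) :=
      (hF'.sub (lipOn_clm T univ)).weaken (by rw [hTn]; linarith [hDM y])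
    refine ⟨U, hUo, hyU, fun η hη => ?_⟩
    obtain ⟨G, hG, hGL, hGF, hGA, hGA'⟩ := hX.exists_approx_of_lipOn hC hε0.le
      (by linarith : ε ≤ L) hL hη hFT hTL
    have hGF' : ∀ x, |F' x - (T x + G x)| ≤ η := fun x => by
      rw [← sub_sub]; exact hGF x
    refine ⟨fun x => T x + G x, T.contDiff.add hG, fun x _ => hGF' x, ?_, fun z hz v => ?_,
      fun x _ => hGF' x, ?_⟩
    · simpa only [sub_sub] using hTL.sub hGA
    · have hd : HasFDerivAt (fun x => T x + G x) (T + fderiv ℝ G z) z :=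
        T.hasFDerivAt.add (hG.differentiable (by norm_num) z).hasFDerivAt
      rw [hd.fderiv, add_apply, add_sub_right_comm, add_mul]
      refine (abs_add_le _ _).trans (add_le_add (hTD z hz v) ?_)
      exact (fderiv ℝ G z).le_of_opNorm_le (hGA' z ⟨z.2, hz⟩) (v : X)
    · simpa only [sub_sub] using hFT.sub hGL) fun η hη => by
    obtain ⟨G, hG, hGL, hGF⟩ := hX l F' hl hF' η hη
    refine ⟨G, hG, fun x _ => hGF x, (hF'.sub hGL).weaken ?_⟩
    have : C * l ≤ C * L := mul_le_mul_of_nonneg_left (by linarith) hC0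
    nlinarith
  refine ⟨h, h1, ?_, fun x hx => ?_, ⟨hD.sub (continuous_derivOn h1),
    hE.sub (conditionE_of_contDiff h1), L / 16, L / 16, by positivity, by positivity, ?_,
    fun y => (h4 y).trans (by linarith), by linarith⟩⟩
  · have := (hF'.sub h5).weaken
      (show l + (L + 18 * C * L + 2 * ε) ≤ 22 * C * L by linarith)
    simpa only [sub_sub_cancel] using this
  · rw [← hFF' x hx]
    exact (h2 x hx).trans (by linarith)
  · intro x hx y hy
    beta_reduce
    rw [← hFF' x hx, ← hFF' y hy]
    exact h3.weaken (by linarith) x hx y hy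

/-! ### Extension of Lipschitz data -/

/-- Iterating the approximation step and summing the corrections, whose Lipschitz constants
decrease geometrically. -/
theorem LipData.exists_extension {C : ℝ} (hX : SmoothApprox X C) (hC : 1 ≤ C)
    {Y : Set X} (hY : IsClosed Y) {L : ℝ} (hL : 0 < L) {F : X → ℝ}
    {D : Y → (diffSpan Y →L[ℝ] ℝ)} (hF : LipData Y L F D) :
    ∃ H : X → ℝ, ContDiff ℝ 1 H ∧ LipOn univ (33 * C * L) H ∧ ∀ y ∈ Y, H y = F y := by
  have hCL : 0 < C * L := by positivity
  rcases Y.eq_empty_or_nonempty with rfl | ⟨x₀, hx₀⟩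
  · exact ⟨fun _ => 0, contDiff_const,
      fun x _ y _ => by rw [sub_self, abs_zero]; positivity, by simp⟩
  have hstep : ∀ (l : ℝ) (p : (X → ℝ) × (Y → (diffSpan Y →L[ℝ] ℝ))), ∃ h : X → ℝ,
      0 < l → LipData Y l p.1 p.2 → ContDiff ℝ 1 h ∧ LipOn univ (22 * C * l) h ∧
        (∀ x ∈ Y, |p.1 x - h x| ≤ l) ∧
        LipData Y (l / 8) (fun x => p.1 x - h x) (fun y => p.2 y - derivOn Y h y) := by
    intro l p
    by_cases h : 0 < l ∧ LipData Y l p.1 p.2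
    · obtain ⟨g, hg⟩ := h.2.exists_approx hX hC hY h.1
      exact ⟨g, fun _ _ => hg⟩
    · exact ⟨0, fun h1 h2 => absurd ⟨h1, h2⟩ h⟩
  choose h hh using hstep
  -- `R n` is the remainder of the data after `n` steps, `u n` the correction of step `n`
  let R : ℕ → (X → ℝ) × (Y → (diffSpan Y →L[ℝ] ℝ)) := fun n =>
    Nat.rec (F, D) (fun n p => (fun x => p.1 x - h (L / 8 ^ n) p x,
      fun y => p.2 y - derivOn Y (h (L / 8 ^ n) p) y)) n
  have hpos : ∀ n : ℕ, 0 < L / 8 ^ n := fun n => by positivity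
  have hR : ∀ n, LipData Y (L / 8 ^ n) (R n).1 (R n).2 := by
    intro n
    induction n with
    | zero => simpa [R] using hF
    | succ n ih =>
      have := (hh _ _ (hpos n) ih).2.2.2
      rwa [div_div, ← pow_succ] at this
  set u : ℕ → X → ℝ := fun n => h (L / 8 ^ n) (R n) with hu
  have hRsucc : ∀ n x, (R (n + 1)).1 x = (R n).1 x - u n x := fun n x => rfl
  have hu1 : ∀ n, ContDiff ℝ 1 (u n) := fun n => (hh _ _ (hpos n) (hR n)).1
  have huL : ∀ n, LipOn univ (22 * C * (L / 8 ^ n)) (u n) := fun n =>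
    (hh _ _ (hpos n) (hR n)).2.1
  have hRle : ∀ n, ∀ x ∈ Y, |(R (n + 1)).1 x| ≤ L / 8 ^ n := fun n =>
    (hh _ _ (hpos n) (hR n)).2.2.1
  have hud : ∀ n x, ‖fderiv ℝ (u n) x‖ ≤ 22 * C * (L / 8 ^ n) := fun n x =>
    (huL n).norm_fderiv_le (by have := hpos n; positivity) x
  have hgeom : HasSum (fun n : ℕ => L / 8 ^ n) (L * (8 / 7)) := by
    have h1 := (hasSum_geometric_of_lt_one (r := (1 / 8 : ℝ)) (by norm_num)
      (by norm_num)).mul_left L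
    have h2 : (1 - 1 / 8 : ℝ)⁻¹ = 8 / 7 := by norm_num
    rw [h2] at h1
    simpa only [one_div, inv_pow, div_eq_mul_inv, one_mul] using h1
  have hgeom' := hgeom.mul_left (22 * C)
  have hYsum : ∀ y ∈ Y, HasSum (fun n => u n y) (F y) := by
    intro y hy
    have hsum : Summable fun n => u n y := by
      refine (summable_nat_add_iff 1).1 ?_
      refine Summable.of_norm_bounded (hgeom.summable.mul_left 2) fun n => ?_
      have e1 : u (n + 1) y = (R (n + 1)).1 y - (R (n + 2)).1 y := by rw [hRsucc (n + 1)]; ring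
      rw [e1, Real.norm_eq_abs]
      have h1 := hRle n y hy
      have h2 := hRle (n + 1) y hy
      have h3 : L / 8 ^ (n + 1) ≤ L / 8 ^ n := by
        rw [pow_succ, ← div_div]; linarith [hpos n]
      exact (abs_sub _ _).trans (by linarith)
    rw [hsum.hasSum_iff_tendsto_nat]
    have hpart : ∀ n, ∑ i ∈ Finset.range n, u i y = F y - (R n).1 y := by
      intro n
      induction n with
      | zero => simp [R]
      | succ n ih => rw [Finset.sum_range_succ, ih, hRsucc]; ring
    have hR0 : Tendsto (fun n => (R n).1 y) atTop (𝓝 0) := by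
      rw [← tendsto_add_atTop_iff_nat 1]
      exact squeeze_zero_norm (fun n => hRle n y hy) hgeom.summable.tendsto_atTop_zero
    simpa only [hpart, sub_zero] using hR0.const_sub (F y)
  have hderiv : ∀ x, HasFDerivAt (fun y => ∑' n, u n y) (∑' n, fderiv ℝ (u n) x) x :=
    hasFDerivAt_tsum hgeom'.summable
      (fun n x => ((hu1 n).differentiable (by norm_num) x).hasFDerivAt) hud (hYsum x₀ hx₀).summable
  refine ⟨fun y => ∑' n, u n y, ?_, ?_, fun y hy => (hYsum y hy).tsum_eq⟩
  · rw [contDiff_one_iff_fderiv]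
    refine ⟨fun x => (hderiv x).differentiableAt, ?_⟩
    rw [funext fun x => (hderiv x).fderiv]
    exact continuous_tsum (fun n => (hu1 n).continuous_fderiv (by norm_num)) hgeom'.summable
      fun n x => hud n x
  · refine lipOn_univ_of_norm_fderiv_le (by positivity) (fun x => (hderiv x).differentiableAt)
      fun x => ?_
    rw [(hderiv x).fderiv]
    exact (tsum_of_norm_bounded hgeom' fun n => hud n x).trans (by nlinarith)

/-! ### The extension theorem -/

/-- Extension of Lipschitz data with bounded derivatives, with the bound on the best Lipschitz
constant. If both constants vanish the function is constant, and this covers the space `{0}`, the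
only one for which property (*) does not force `1 ≤ C₀`. -/
theorem PropertyStarWith.exists_lip_extension {C₀ : ℝ} (hX : PropertyStarWith X C₀) {Y : Set X}
    (hY : IsClosed Y) {f : Y → ℝ} (hf : IsLip f) {D : Y → (diffSpan Y →L[ℝ] ℝ)}
    (hD : Continuous D) (hE : ConditionE f D) (hb : BddAbove (range fun y => ‖D y‖)) :
    ∃ H : X → ℝ, ContDiff ℝ 1 H ∧ IsLip H ∧ (∀ y : Y, H y = f y) ∧
      Lip H ≤ (1 + 33 * C₀) * ((⨆ y, ‖D y‖) + Lip f) := by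
  set M : ℝ := ⨆ y, ‖D y‖ with hM
  have hM0 : 0 ≤ M := Real.iSup_nonneg fun y => norm_nonneg (D y)
  have hDM : ∀ y, ‖D y‖ ≤ M := fun y => le_ciSup hb y
  have hl0 := Lip_nonneg f
  have hfl := hf.dist_le
  rcases (add_nonneg hM0 hl0).eq_or_lt with hL | hL
  · have hconst : ∃ c, ∀ y, c = f y := by
      rcases isEmpty_or_nonempty Y with _ | ⟨⟨y₀⟩⟩
      · exact ⟨0, isEmptyElim⟩
      · refine ⟨f y₀, fun y => ?_⟩
        have h1 := hfl y₀ y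
        rw [show Lip f = 0 by linarith, zero_mul] at h1
        exact sub_eq_zero.1 (abs_nonpos_iff.1 h1)
    obtain ⟨c, hc⟩ := hconst
    have hlip : LipOn univ 0 (fun _ : X => c) := fun x _ y _ => by simp
    obtain ⟨h1, h2⟩ := hlip.isLip le_rfl
    exact ⟨fun _ => c, contDiff_const, h1, hc, by rwa [← hL, mul_zero]⟩
  have hnt : Nontrivial X := by
    by_contra hnt
    have hsub : Subsingleton X := not_nontrivial_iff_subsingleton.1 hnt
    have hD0 : ∀ y, ‖D y‖ = 0 := fun y => by
      have h0 : D y = 0 := by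
        ext v
        rw [Subsingleton.elim v 0, map_zero, map_zero]
      rw [h0]
      exact ContinuousLinearMap.opNorm_zero
    have h1 : M = 0 := by rw [hM]; simp [hD0]
    have h2 := (isLip_and_Lip_le le_rfl fun x y : Y => by
      rw [Subsingleton.elim x y]; simp : IsLip f ∧ Lip f ≤ 0).2
    linarith
  have hC := hX.one_le
  set F : X → ℝ := Function.extend Subtype.val f 0 with hFdef
  have hFf : ∀ y : Y, F y = f y := fun y => Subtype.val_injective.extend_apply f 0 y
  have hdata : LipData Y (M + Lip f) F D := by
    refine ⟨hD, ?_, Lip f, M, hl0, hM0, fun x hx y hy => ?_, hDM, by linarith⟩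
    · rwa [funext hFf]
    · have := hfl ⟨x, hx⟩ ⟨y, hy⟩
      rw [← hFf, ← hFf] at this
      rwa [Subtype.dist_eq, dist_eq_norm] at this
  obtain ⟨H, hH, hHL, hHF⟩ := hdata.exists_extension (hX.smoothApprox (by linarith)) hC hY hL
  obtain ⟨h1, h2⟩ := hHL.isLip (by positivity)
  exact ⟨H, hH, h1, fun y => (hHF y y.2).trans (hFf y), h2.trans (by linarith)⟩

theorem PropertyStarWith.exists_contDiff_extension {C₀ : ℝ} (hX : PropertyStarWith X C₀)
    {Y : Set X} (hY : IsClosed Y) {f : Y → ℝ} {D : Y → (diffSpan Y →L[ℝ] ℝ)}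
    (hD : Continuous D) (hE : ConditionE f D) :
    ∃ H : X → ℝ, ContDiff ℝ 1 H ∧ ∀ y : Y, H y = f y := by
  set C := max C₀ 1
  have hC1 : 1 ≤ C := le_max_right _ _
  have hS : SmoothApprox X C := (hX.mono (le_max_left _ _)).smoothApprox (by linarith)
  set F : X → ℝ := Function.extend Subtype.val f 0
  have hFf : ∀ y : Y, F y = f y := fun y => Subtype.val_injective.extend_apply f 0 y
  have hE' : ConditionE (fun y : Y => F y) D := by rwa [funext hFf]
  obtain ⟨h, h1, h2, h3⟩ := hS.exists_sub_lip (by linarith) hY hD hE'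
  have hdata : LipData Y ((C + 3) + (C + 3)) (fun x => F x - h x)
      (fun y => D y - derivOn Y h y) :=
    ⟨hD.sub (continuous_derivOn h1), hE'.sub (conditionE_of_contDiff h1), _, _, by linarith,
      by linarith, h2, h3, le_rfl⟩
  obtain ⟨H, hH, -, hHF⟩ := hdata.exists_extension hS hC1 hY (by linarith)
  refine ⟨fun x => h x + H x, h1.add hH, fun y => ?_⟩
  beta_reduce
  rw [hHF y y.2, ← hFf]
  ring

end

theorem mainTheorem2 {X : Type*} [NormedAddCommGroup X] [NormedSpace ℝ X] [CompleteSpace X]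
    (hX : PropertyStar X) (Y : Set X) (hY : IsClosed Y) (f : Y → ℝ) :
    ((∃ D : Y → (diffSpan Y →L[ℝ] ℝ), Continuous D ∧ ConditionE f D) ↔
      ∃ H : X → ℝ, ContDiff ℝ 1 H ∧ ∀ y : Y, H y = f y) ∧
    (IsLip f →
      ((∃ D : Y → (diffSpan Y →L[ℝ] ℝ), Continuous D ∧ ConditionE f D ∧
          BddAbove (Set.range fun y => ‖D y‖)) ↔
        ∃ H : X → ℝ, ContDiff ℝ 1 H ∧ IsLip H ∧ ∀ y : Y, H y = f y) ∧
      ∀ C₀ : ℝ, PropertyStarWith X C₀ →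
        ∀ D : Y → (diffSpan Y →L[ℝ] ℝ), Continuous D → ConditionE f D →
          BddAbove (Set.range fun y => ‖D y‖) →
          ∃ H : X → ℝ, ContDiff ℝ 1 H ∧ IsLip H ∧ (∀ y : Y, H y = f y) ∧
            Lip H ≤ (1 + 33 * C₀) * ((⨆ y, ‖D y‖) + Lip f)) := by
  obtain ⟨C, hC⟩ := hX
  have hback : ∀ H : X → ℝ, ContDiff ℝ 1 H → (∀ y : Y, H y = f y) →
      ConditionE f (derivOn Y H) := fun H hH hHf => by
    have := conditionE_of_contDiff (Y := Y) hH
    rwa [funext hHf] at this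
  refine ⟨⟨?_, ?_⟩, fun hf => ⟨⟨?_, ?_⟩, ?_⟩⟩
  · rintro ⟨D, hD, hE⟩
    exact hC.exists_contDiff_extension hY hD hE
  · rintro ⟨H, hH, hHf⟩
    exact ⟨_, continuous_derivOn hH, hback H hH hHf⟩
  · rintro ⟨D, hD, hE, hb⟩
    obtain ⟨H, hH, hHL, hHf, -⟩ := hC.exists_lip_extension hY hf hD hE hb
    exact ⟨H, hH, hHL, hHf⟩
  · rintro ⟨H, hH, ⟨K, hK⟩, hHf⟩
    refine ⟨_, continuous_derivOn hH, hback H hH hHf, K, ?_⟩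
    rintro _ ⟨y, rfl⟩
    exact norm_derivOn_le Y K.2 hK.lipOn y
  · intro C₀ hC₀ D hD hE hb
    exact hC₀.exists_lip_extension hY hf hD hE hb
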